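/- Let $0<\alpha<1$, let $X\neq\{0\}$ be a complex Banach space with open unit ball $\mathbb{B}$, and for $z\in X\setminus\{0\}$ let $T_z$ be the set of continuous linear functionals $l_z:X\to\mathbb{C}$ with $\|l_z\|=1$ and $l_z(z)=\|z\|$. Let $\mathcal{S}^*_\alpha(\mathbb{B})$ be the class of starlike mappings of order $\alpha$, that is, of holomorphic mappings $G:\mathbb{B}\to X$ with $G(0)=0$, $DG(0)=I$ and $DG(z)$ boundedly invertible for every $z\in\mathbb{B}$, such that $$\left|\frac{1}{\|z\|}\,l_z\big([DG(z)]^{-1}G(z)\big)-\frac{1}{2\alpha}\right|<\frac{1}{2\alpha}\qquad\text{for all } z\in\mathbb{B}\setminus\{0\},\ l_z\in T_z .$$ (i) Let $g:\mathbb{B}\to\mathbb{C}$ be holomorphic with $g(0)=1$ and suppose that $G(z)=z\,g(z)$ belongs to $\mathcal{S}^*_\alpha(\mathbb{B})$. Then for all $z\in\mathbb{B}\setminus\{0\}$ and $l_z\in T_z$ $$\left|\left(\frac{l_z(D^2G(0)(z^2))}{2!\,\|z\|^2}\right)^2-\left(\frac{l_z(D^3G(0)(z^3))}{3!\,\|z\|^3}\right)^2\right|\le(1-\alpha)^2(4\alpha^2-12\alpha+13).$$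 This is sharp: for every such $X$ and $\alpha$ there is such a $g$ for which equality holds for some $z\in\mathbb{B}\setminus\{0\}$ and $l_z\in T_z$. (ii) Let $n\ge1$, let $X=\mathbb{C}^n$ with the maximum norm, so that $\mathbb{B}=\mathbb{U}^n$ is the unit polydisc, and let squares of vectors in $\mathbb{C}^n$ be taken coordinatewise. If $g:\mathbb{U}^n\to\mathbb{C}$ is holomorphic with $g(0)=1$ and $G(z)=z\,g(z)$ belongs to $\mathcal{S}^*_\alpha(\mathbb{U}^n)$, then for all $z\in\mathbb{U}^n$ $$\left\|\left(\frac{D^3G(0)(z^3)}{3!}\right)^2-\left(\frac{D^2G(0)(z^2)}{2!}\right)^2\right\|\le(1-\alpha)^2\big((3-2\alpha)^2\|z\|^6+4\|z\|^4\big).$$ This is sharp: for every $n\ge1$ and $\alpha$ there is such a $g$ such that for every $0\le r<1$ equality holds for some $z$ with $\|z\|=r$. -/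

import Mathlib

open Metric

/-- The set `T_z` of norm-one continuous linear functionals `l` on `X` with `l z = ‖z‖`. -/
def supportFunctionals {X : Type*} [NormedAddCommGroup X] [NormedSpace ℂ X] (z : X) :
    Set (X →L[ℂ] ℂ) :=
  {l | l z = (‖z‖ : ℂ) ∧ ‖l‖ = 1}

/-- Starlike mappings of order `α` (for `0 < α < 1`) on the open unit ball of a complex Banach
space: normalized locally biholomorphic mappings `G` of the ball such that
`|l_z([DG(z)]⁻¹ G(z)) / ‖z‖ - 1/(2α)| < 1/(2α)` for all `z ≠ 0` in the ball and all `l_z ∈ T_z`. -/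
structure IsStarlikeOfOrder {X : Type*} [NormedAddCommGroup X] [NormedSpace ℂ X]
    (α : ℝ) (G : X → X) : Prop where
  holomorphic : DifferentiableOn ℂ G (ball 0 1)
  map_zero : G 0 = 0
  fderiv_zero : fderiv ℂ G 0 = ContinuousLinearMap.id ℂ X
  locally_biholomorphic : ∀ z ∈ ball (0 : X) 1, (fderiv ℂ G z).IsInvertible
  starlike : ∀ z ∈ ball (0 : X) 1, z ≠ 0 → ∀ l ∈ supportFunctionals z,
    ‖1 / (‖z‖ : ℂ) * l ((fderiv ℂ G z).inverse (G z)) - 1 / (2 * (α : ℂ))‖ < 1 / (2 * α)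

/-- The `k`-th term `D^k G(0)(z^k) / k!` of the homogeneous expansion of `G` at the origin. -/
noncomputable def homogeneousTerm {X : Type*} [NormedAddCommGroup X] [NormedSpace ℂ X]
    (G : X → X) (k : ℕ) (z : X) : X :=
  (1 / (k.factorial : ℂ)) • iteratedFDeriv ℂ k G 0 (fun _ => z)

/-!
For `G z = g z • z` the derivative `DG(z)` maps `z` to `(g z + Dg(z) z) • z`, so `[DG(z)]⁻¹ G(z)` is
`z` multiplied by `g z / (g z + Dg(z) z)`, and starlikeness of order `α` says exactly that
`Re ((g z + Dg(z) z) / g z) > α` (`IsStarlikeOfOrder.lt_re` and its converse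
`isStarlikeOfOrder_smul_self`). Along the complex line through `z`, with `ψ t = g (t • z)`, this is
`Re (1 + t ψ'(t) / ψ(t)) > α` on the disc of radius `1 / ‖z‖`: the function `t ψ(t)` is starlike of
order `α` in the classical sense. Carathéodory's inequality `norm_iteratedDeriv_le_of_re_pos` gives
`|ψ'(0)| ≤ 2 (1 - α) ‖z‖` and `|ψ''(0) / 2| ≤ (1 - α) (3 - 2 α) ‖z‖ ^ 2`, and both estimates follow
by the triangle inequality.

The homogeneous terms of `G` are these Taylor coefficients times `z` (`homogeneousTerm_smul_self`).
This rests on the smoothness of Fréchet holomorphic maps between Banach spaces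
(`contDiffOn_of_differentiableOn_complex`), without which the iterated Fréchet derivatives could
have junk values.

Equality holds for `g z = (1 - i u(z)) ^ (-2 (1 - α))` with `u` a linear functional of norm one, at
a point where `u` attains its norm: the second coefficient is imaginary and the third is real, both
of maximal modulus, so that their squares have opposite signs and the triangle inequality is sharp.
-/

/-! ### Holomorphic maps between Banach spaces are smooth -/

section Smoothness

open Filter Topology Asymptotics Set

variable {E F : Type*} [NormedAddCommGroup E] [NormedSpace ℂ E]
  [NormedAddCommGroup F] [NormedSpace ℂ F]

/-- Second order remainder estimate: subtracting the linear part leaves a map vanishing to second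
order, to which the Schwarz lemma applies. -/
lemma norm_sub_sub_fderiv_le_of_mapsTo_ball {f : E → F} {x y : E} {R M : ℝ}
    (hd : DifferentiableOn ℂ f (ball x R)) (hm : MapsTo f (ball x R) (closedBall (f x) M))
    (hy : y ∈ ball x R) :
    ‖f y - f x - fderiv ℂ f x (y - x)‖ ≤ 2 * M * (‖y - x‖ / R) ^ 2 := by
  have hR : 0 < R := nonempty_ball.mp ⟨_, hy⟩
  have hfx : DifferentiableAt ℂ f x := hd.differentiableAt (ball_mem_nhds x hR)
  have hbound := Complex.norm_fderiv_le_div_of_mapsTo_ball hd hm hR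
  have key := Complex.dist_le_mul_div_pow_of_mapsTo_ball_of_isLittleO
    (f := fun w => f w - fderiv ℂ f x (w - x)) (c := x) (z := y) (R₁ := R) (R₂ := 2 * M) (n := 1)
    (hd.sub (by fun_prop)) ?_ ?_ hy
  · simpa [dist_eq_norm, sub_right_comm] using key
  · intro w hw
    have h1 : ‖f w - f x‖ ≤ M := by simpa [dist_eq_norm] using hm hw
    have h2 : ‖fderiv ℂ f x (w - x)‖ ≤ M := by
      have hM : 0 ≤ M := (norm_nonneg _).trans h1
      have hw' : ‖w - x‖ ≤ R := by simpa [dist_eq_norm] using (mem_ball.1 hw).le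
      calc ‖fderiv ℂ f x (w - x)‖ ≤ M / R * R :=
            (fderiv ℂ f x).le_of_opNorm_le_of_le hbound hw'
        _ = M := by field_simp
    simp only [sub_self, map_zero, sub_zero, mem_closedBall, dist_eq_norm]
    rw [sub_right_comm]
    exact (norm_sub_le _ _).trans (by linarith)
  · have := hfx.hasFDerivAt.isLittleO
    simp only [sub_self, map_zero, sub_zero, pow_one]
    refine (this.norm_right).congr_left fun w => by abel

/-- A uniform limit of holomorphic maps on a ball of a normed space is differentiable at the centre:
by the Schwarz lemma the derivatives converge uniformly on the concentric ball of half radius. -/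
lemma differentiableAt_of_tendstoUniformlyOn_ball [CompleteSpace F] {ι : Type*} {l : Filter ι}
    [NeBot l] {f : ι → E → F} {g : E → F} {x : E} {R : ℝ} (hR : 0 < R)
    (hf : ∀ᶠ n in l, DifferentiableOn ℂ (f n) (ball x R))
    (hg : TendstoUniformlyOn f g l (ball x R)) : DifferentiableAt ℂ g x := by
  have hcauchy : UniformCauchySeqOn (fun n => fderiv ℂ (f n)) l (ball x (R / 2)) := by
    intro u hu
    obtain ⟨ε, hε, hεu⟩ := Metric.mem_uniformity_dist.1 hu
    filter_upwards [hg.uniformCauchySeqOn _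
      (Metric.dist_mem_uniformity (ε := ε * R / 8) (by positivity)), hf.prod_mk hf]
      with p hp hd y hy
    have hsub : ball y (R / 2) ⊆ ball x R := ball_subset_ball' (by linarith [mem_ball.1 hy])
    have hyR : y ∈ ball x R := hsub (mem_ball_self (by positivity))
    have hbound : ‖fderiv ℂ (fun w => f p.1 w - f p.2 w) y‖ ≤ ε / 2 := by
      refine (Complex.norm_fderiv_le_div_of_mapsTo_ball (R₁ := R / 2) (R₂ := ε * R / 4)
        ((hd.1.sub hd.2).mono hsub) (fun w hw => ?_) (by positivity)).trans_eq
        (by field_simp; norm_num)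
      have h1 : ‖f p.1 w - f p.2 w‖ < ε * R / 8 := by simpa [dist_eq_norm] using hp w (hsub hw)
      have h2 : ‖f p.1 y - f p.2 y‖ < ε * R / 8 := by simpa [dist_eq_norm] using hp y hyR
      rw [mem_closedBall, dist_eq_norm]
      exact (norm_sub_le (f p.1 w - f p.2 w) (f p.1 y - f p.2 y)).trans (by linarith)
    refine hεu ?_
    rw [dist_eq_norm]
    rw [fderiv_fun_sub (hd.1.differentiableAt (isOpen_ball.mem_nhds hyR))
      (hd.2.differentiableAt (isOpen_ball.mem_nhds hyR))] at hbound
    linarith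
  choose! g' hg' using fun y (hy : y ∈ ball x (R / 2)) =>
    cauchy_map_iff_exists_tendsto.1 (hcauchy.cauchy_map hy)
  have hunif := hcauchy.tendstoUniformlyOn_of_tendsto hg'
  have hnhds : ball x (R / 2) ∈ 𝓝 x := ball_mem_nhds x (by positivity)
  refine (hasFDerivAt_of_tendstoUniformlyOnFilter (l := l) (f := f)
    (f' := fun n => fderiv ℂ (f n)) (g' := g') ?_ ?_ ?_).differentiableAt
  · exact (tendstoUniformlyOn_iff_tendstoUniformlyOnFilter.1 hunif).mono_right
      (le_principal_iff.2 hnhds)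
  · filter_upwards [hf.prod_mk (ball_mem_nhds x hR)] with p hp
    exact (hp.1.differentiableAt (isOpen_ball.mem_nhds hp.2)).hasFDerivAt
  · filter_upwards [ball_mem_nhds x hR] with y hy using hg.tendsto_at hy

/-- A holomorphic map is bounded near each point, uniformly over balls of one radius. -/
lemma exists_forall_mapsTo_closedBall {f : E → F} {U : Set E} {x : E}
    (hf : DifferentiableOn ℂ f U) (hU : U ∈ 𝓝 x) :
    ∃ δ > 0, ∀ y ∈ ball x δ, DifferentiableOn ℂ f (ball y δ) ∧
      MapsTo f (ball y δ) (closedBall (f y) 2) := by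
  have hc : ContinuousAt f x := (hf.differentiableAt hU).continuousAt
  obtain ⟨r, hr, hrU⟩ := Metric.mem_nhds_iff.1
    (inter_mem hU (hc (closedBall_mem_nhds (f x) one_pos)))
  refine ⟨r / 2, by positivity, fun y hy => ?_⟩
  have hsub : ball y (r / 2) ⊆ ball x r :=
    ball_subset_ball' (by linarith [mem_ball.1 hy])
  refine ⟨hf.mono fun w hw => (hrU (hsub hw)).1, fun w hw => ?_⟩
  have h1 : dist (f w) (f x) ≤ 1 := (hrU (hsub hw)).2
  have h2 : dist (f y) (f x) ≤ 1 := (hrU (hsub (mem_ball_self (by positivity)))).2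
  exact (dist_triangle_right _ _ (f x)).trans (by linarith)

/-- Directional derivatives of a holomorphic map are locally uniform limits of difference
quotients, hence differentiable. -/
lemma differentiableAt_fderiv_apply [CompleteSpace F] {f : E → F} {U : Set E} {x : E}
    (hf : DifferentiableOn ℂ f U) (hU : U ∈ 𝓝 x) (h : E) :
    DifferentiableAt ℂ (fun y => fderiv ℂ f y h) x := by
  obtain ⟨δ, hδ, H⟩ := exists_forall_mapsTo_closedBall hf hU
  have hsmall : Tendsto (fun t : ℂ => ‖t • h‖) (𝓝[≠] 0) (𝓝 0) := by
    have : Continuous fun t : ℂ => ‖t • h‖ := by fun_prop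
    simpa using (this.tendsto 0).mono_left nhdsWithin_le_nhds
  have hlt : ∀ᶠ t : ℂ in 𝓝[≠] 0, ‖t • h‖ < δ := hsmall.eventually (gt_mem_nhds hδ)
  refine differentiableAt_of_tendstoUniformlyOn_ball (l := 𝓝[≠] (0 : ℂ)) hδ
    (f := fun t y => t⁻¹ • (f (y + t • h) - f y)) ?_ ?_
  · filter_upwards [hlt] with t ht
    have hdiff : ∀ y ∈ ball x δ, DifferentiableAt ℂ f (y + t • h) := fun y hy =>
      (H y hy).1.differentiableAt (isOpen_ball.mem_nhds (by simpa [dist_eq_norm] using ht))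
    intro y hy
    have h1 : DifferentiableAt ℂ (fun y => f (y + t • h)) y :=
      (hdiff y hy).comp y (by fun_prop : DifferentiableAt ℂ (fun y => y + t • h) y)
    have h2 : DifferentiableAt ℂ f y :=
      (H y hy).1.differentiableAt (ball_mem_nhds y hδ)
    exact ((h1.sub h2).const_smul _).differentiableWithinAt
  · rw [Metric.tendstoUniformlyOn_iff]
    intro ε hε
    have hlim : Tendsto (fun t : ℂ => ‖t‖ * (4 * (‖h‖ / δ) ^ 2)) (𝓝[≠] 0) (𝓝 0) := by
      have : Continuous fun t : ℂ => ‖t‖ * (4 * (‖h‖ / δ) ^ 2) := by fun_prop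
      simpa using (this.tendsto 0).mono_left nhdsWithin_le_nhds
    filter_upwards [hlt, hlim.eventually (gt_mem_nhds hε), self_mem_nhdsWithin]
      with t ht hte ht0 y hy
    have ht0' : t ≠ 0 := ht0
    refine lt_of_le_of_lt ?_ hte
    have key := norm_sub_sub_fderiv_le_of_mapsTo_ball (H y hy).1 (H y hy).2
      (y := y + t • h) (by simpa [dist_eq_norm] using ht)
    rw [add_sub_cancel_left, map_smul, norm_smul] at key
    have : fderiv ℂ f y h - t⁻¹ • (f (y + t • h) - f y)
        = -(t⁻¹ • (f (y + t • h) - f y - t • fderiv ℂ f y h)) := by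
      rw [smul_sub t⁻¹ (_ - _), inv_smul_smul₀ ht0']; abel
    rw [dist_eq_norm, this, norm_neg, norm_smul, norm_inv]
    have htp : 0 < ‖t‖ := norm_pos_iff.2 ht0'
    calc _ ≤ ‖t‖⁻¹ * (2 * 2 * (‖t‖ * ‖h‖ / δ) ^ 2) := by gcongr
      _ = _ := by field_simp; ring

/-- The derivative of a holomorphic map into a Banach space is holomorphic for the operator norm.
The second derivative is assembled from the derivatives of the directional derivatives, and the
Schwarz lemma makes the remainder quadratic uniformly in the direction. -/
lemma differentiableAt_fderiv_of_differentiableOn [CompleteSpace F] {f : E → F} {U : Set E} {x : E}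
    (hf : DifferentiableOn ℂ f U) (hU : U ∈ 𝓝 x) : DifferentiableAt ℂ (fderiv ℂ f) x := by
  obtain ⟨δ, hδ, H⟩ := exists_forall_mapsTo_closedBall hf hU
  have hφ : ∀ h, ∀ y ∈ ball x δ, DifferentiableAt ℂ (fun y => fderiv ℂ f y h) y := fun h y hy =>
    differentiableAt_fderiv_apply (H y hy).1 (ball_mem_nhds y hδ) h
  have hφd : ∀ h, DifferentiableOn ℂ (fun y => fderiv ℂ f y h) (ball x δ) := fun h y hy =>
    (hφ h y hy).differentiableWithinAt
  have hx : x ∈ ball x δ := mem_ball_self hδ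
  have hnorm : ∀ h, ∀ y ∈ ball x δ, ‖fderiv ℂ f y h‖ ≤ 2 / δ * ‖h‖ := fun h y hy =>
    (fderiv ℂ f y).le_of_opNorm_le
      (Complex.norm_fderiv_le_div_of_mapsTo_ball (H y hy).1 (H y hy).2 hδ) h
  have hmaps : ∀ h, MapsTo (fun y => fderiv ℂ f y h) (ball x δ)
      (closedBall (fderiv ℂ f x h) (4 / δ * ‖h‖)) := by
    intro h y hy
    rw [mem_closedBall, dist_eq_norm]
    refine (norm_sub_le _ _).trans ((add_le_add (hnorm h y hy) (hnorm h x hx)).trans_eq ?_)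
    ring
  let B : E →L[ℂ] E →L[ℂ] F := LinearMap.mkContinuous
    { toFun := fun h => fderiv ℂ (fun y => fderiv ℂ f y h) x
      map_add' := fun h k => by
        simp only [map_add]
        exact fderiv_fun_add (hφ h x hx) (hφ k x hx)
      map_smul' := fun c h => by
        simp only [map_smul, RingHom.id_apply]
        exact fderiv_fun_const_smul (hφ h x hx) c } (4 / δ / δ) fun h => by
        refine (Complex.norm_fderiv_le_div_of_mapsTo_ball (hφd h) (hmaps h) hδ).trans_eq ?_
        ring
  have hB : ∀ h k, B.flip k h = fderiv ℂ (fun y => fderiv ℂ f y h) x k := fun h k => rfl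
  refine (HasFDerivAt.of_isLittleO (f' := B.flip) ?_).differentiableAt
  have hO : (fun y => fderiv ℂ f y - fderiv ℂ f x - B.flip (y - x)) =O[𝓝 x]
      fun y => ‖y - x‖ ^ 2 := by
    refine IsBigO.of_bound (8 / δ ^ 3) ?_
    filter_upwards [ball_mem_nhds x hδ] with y hy
    refine ContinuousLinearMap.opNorm_le_bound _ (by positivity) fun h => ?_
    have := norm_sub_sub_fderiv_le_of_mapsTo_ball (hφd h) (hmaps h) hy
    simp only [sub_apply, hB, norm_pow, norm_norm]
    refine this.trans_eq ?_
    field_simp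
    ring
  exact hO.trans_isLittleO (isLittleO_pow_sub_sub x one_lt_two)

/-- A Fréchet holomorphic map on an open subset of a normed space, with values in a Banach space,
is smooth. -/
theorem contDiffOn_of_differentiableOn_complex.{u} {E F : Type u} [NormedAddCommGroup E]
    [NormedSpace ℂ E] [NormedAddCommGroup F] [NormedSpace ℂ F] [CompleteSpace F] {f : E → F}
    {U : Set E} (hU : IsOpen U) (hf : DifferentiableOn ℂ f U) (n : ℕ) : ContDiffOn ℂ n f U := by
  induction n generalizing F with
  | zero => exact contDiffOn_zero.2 hf.continuousOn
  | succ n ih =>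
    rw [Nat.cast_succ, contDiffOn_succ_iff_fderiv_of_isOpen hU]
    refine ⟨hf, by simp, ih fun x hx => ?_⟩
    exact (differentiableAt_fderiv_of_differentiableOn hf (hU.mem_nhds hx)).differentiableWithinAt

end Smoothness

/-! ### Taylor coefficients of functions with positive real part -/

section PositiveRealPart

open Complex Real Set MeasureTheory

/-- **Carathéodory's inequality** for the Taylor coefficients of a holomorphic function with
positive real part: on a circle of radius `r` the `n`-th coefficient of `p` is also the `n`-th
Fourier coefficient of `2 Re p`, which is bounded by the mean of that nonnegative function. -/
theorem norm_iteratedDeriv_le_of_re_pos {p : ℂ → ℂ} {R : ℝ} (hR : 0 < R)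
    (hp : DifferentiableOn ℂ p (ball 0 R)) (h0 : p 0 = 1) (hre : ∀ z ∈ ball 0 R, 0 < (p z).re)
    {n : ℕ} (hn : n ≠ 0) : ‖iteratedDeriv n p 0‖ ≤ 2 * n.factorial / R ^ n := by
  have hr : ∀ r ∈ Ioo 0 R, ‖iteratedDeriv n p 0‖ * r ^ n ≤ 2 * n.factorial := by
    rintro r ⟨hr0, hrR⟩
    have hsub : closedBall (0 : ℂ) r ⊆ ball 0 R := closedBall_subset_ball hrR
    have hpd := hp.mono hsub
    set e : ℝ → ℂ := fun θ => circleMap 0 r θ with he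
    have he0 : ∀ θ, e θ ≠ 0 := fun θ => circleMap_ne_center hr0.ne'
    have hnorm : ∀ θ, ‖e θ‖ = r := fun θ => by simp [he, abs_of_pos hr0]
    have hec : Continuous e := continuous_circleMap 0 r
    have hmem : ∀ θ, e θ ∈ closedBall (0 : ℂ) r := fun θ =>
      circleMap_mem_closedBall 0 hr0.le θ
    have hpc : Continuous fun θ => p (e θ) := hpd.continuousOn.comp_continuous hec hmem
    have hinvc : Continuous fun θ => ((e θ) ^ n)⁻¹ :=
      (hec.pow n).inv₀ fun θ => pow_ne_zero n (he0 θ)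
    -- the nonnegative Fourier coefficients of `p`
    have h1 : ∀ n : ℕ, ∫ θ in 0..2 * π, ((e θ) ^ n)⁻¹ * p (e θ)
        = 2 * π / n.factorial * iteratedDeriv n p 0 := by
      intro n
      have := hpd.circleIntegral_one_div_sub_center_pow_smul hr0 n
      rw [circleIntegral] at this
      have hI : ∀ θ, deriv (circleMap 0 r) θ • ((1 / (circleMap 0 r θ - 0) ^ (n + 1)) •
          p (circleMap 0 r θ)) = I * (((e θ) ^ n)⁻¹ * p (e θ)) := fun θ => by
        have := he0 θ
        simp only [deriv_circleMap, sub_zero, smul_eq_mul, he] at this ⊢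
        field_simp
        ring
      simp only [hI] at this
      rw [intervalIntegral.integral_const_mul, smul_eq_mul] at this
      apply mul_left_cancel₀ I_ne_zero
      rw [this]; ring
    -- the negative Fourier coefficients of `p` vanish, so `conj p` has no positive ones
    have h2 : ∫ θ in 0..2 * π, (e θ) ^ n * p (e θ) = 0 := by
      have hd : DifferentiableOn ℂ (fun z => z ^ (n - 1) * p z) (closedBall 0 r) := by fun_prop
      have := (hd.mono closure_ball_subset_closedBall).diffContOnCl.circleIntegral_eq_zero hr0.le
      rw [circleIntegral] at this
      have hI : ∀ θ, deriv (circleMap 0 r) θ • ((circleMap 0 r θ) ^ (n - 1) *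
          p (circleMap 0 r θ)) = I * ((e θ) ^ n * p (e θ)) := fun θ => by
        simp only [deriv_circleMap, smul_eq_mul, he]
        rw [← mul_pow_sub_one hn (circleMap 0 r θ)]
        ring
      simp only [hI] at this
      rw [intervalIntegral.integral_const_mul] at this
      exact (mul_eq_zero.1 this).resolve_left I_ne_zero
    have h3 : ∫ θ in 0..2 * π, ((e θ) ^ n)⁻¹ * (starRingEnd ℂ) (p (e θ)) = 0 := by
      have hconj : ∀ θ, ((e θ) ^ n)⁻¹ * (starRingEnd ℂ) (p (e θ))
          = ((r : ℂ) ^ (2 * n))⁻¹ * (starRingEnd ℂ) ((e θ) ^ n * p (e θ)) := fun θ => by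
        have h := Complex.mul_conj' (e θ)
        rw [hnorm] at h
        have hc : (starRingEnd ℂ) (e θ) = (r : ℂ) ^ 2 * (e θ)⁻¹ := by
          rw [← h]; field_simp [he0 θ]
        have hrc : (r : ℂ) ≠ 0 := by exact_mod_cast hr0.ne'
        rw [map_mul, map_pow, hc, pow_mul, mul_pow, inv_pow]
        field_simp
      simp only [hconj]
      rw [intervalIntegral.integral_const_mul, intervalIntegral.intervalIntegral_conj, h2]
      simp
    have h4 : ∫ θ in 0..2 * π, ((e θ) ^ n)⁻¹ * ((2 * (p (e θ)).re : ℝ) : ℂ)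
        = 2 * π / n.factorial * iteratedDeriv n p 0 := by
      have : ∀ θ, ((e θ) ^ n)⁻¹ * ((2 * (p (e θ)).re : ℝ) : ℂ)
          = ((e θ) ^ n)⁻¹ * p (e θ) + ((e θ) ^ n)⁻¹ * (starRingEnd ℂ) (p (e θ)) := fun θ => by
        rw [← mul_add, Complex.add_conj]
      simp only [this]
      rw [intervalIntegral.integral_add, h1, h3, add_zero]
      · exact (hinvc.mul hpc).intervalIntegrable _ _
      · exact (hinvc.mul (continuous_conj.comp hpc)).intervalIntegrable _ _
    -- the mean of `Re p` is `Re p(0) = 1`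
    have h5 : ∫ θ in 0..2 * π, (p (e θ)).re = 2 * π := by
      have := congrArg re (h1 0)
      simp only [pow_zero, inv_one, one_mul, iteratedDeriv_zero, h0] at this
      rw [← reCLM_apply, ← reCLM.intervalIntegral_comp_comm (hpc.intervalIntegrable _ _)] at this
      simpa using this
    have h6 : ‖2 * π / n.factorial * iteratedDeriv n p 0‖ ≤ (r ^ n)⁻¹ * (2 * (2 * π)) := by
      rw [← h4]
      have h5' : (r ^ n)⁻¹ * (2 * (2 * π)) = ∫ θ in 0..2 * π, (r ^ n)⁻¹ * (2 * (p (e θ)).re) := by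
        rw [intervalIntegral.integral_const_mul, intervalIntegral.integral_const_mul, h5]
      rw [h5']
      refine (intervalIntegral.norm_integral_le_integral_norm (by positivity)).trans_eq ?_
      refine intervalIntegral.integral_congr fun θ _ => ?_
      have := hre _ (hsub (hmem θ))
      simp [hnorm, abs_of_pos this]
    have hpi : (0 : ℝ) < 2 * π := by positivity
    have hnf : (0 : ℝ) < n.factorial := by exact_mod_cast n.factorial_pos
    have hrn : 0 < r ^ n := by positivity
    have h7 : ‖(2 * π / n.factorial : ℂ)‖ = 2 * π / n.factorial := by
      simp [abs_of_pos pi_pos]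
    rw [norm_mul, h7, inv_mul_eq_div, le_div_iff₀ hrn, div_mul_eq_mul_div, div_mul_eq_mul_div,
      div_le_iff₀ hnf] at h6
    nlinarith
  rw [le_div_iff₀ (by positivity)]
  have hlim : Filter.Tendsto (fun r => ‖iteratedDeriv n p 0‖ * r ^ n) (nhdsWithin R (Iio R))
      (nhds (‖iteratedDeriv n p 0‖ * R ^ n)) :=
    ((by fun_prop : Continuous fun r : ℝ => ‖iteratedDeriv n p 0‖ * r ^ n).tendsto R).mono_left
      nhdsWithin_le_nhds
  exact le_of_tendsto hlim (Filter.eventually_of_mem (Ioo_mem_nhdsLT hR) hr)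

end PositiveRealPart

/-! ### The starlikeness condition for maps of the form `z ↦ g z • z` -/

section Starlike

variable {X : Type*} [NormedAddCommGroup X] [NormedSpace ℂ X]

/-- The disc with diameter `(0, 1/α)` is the image of the half-plane `α < re` under inversion. -/
lemma norm_inv_sub_lt_iff {q : ℂ} {α : ℝ} (hα : 0 < α) (hq : q ≠ 0) :
    ‖q⁻¹ - 1 / (2 * (α : ℂ))‖ < 1 / (2 * α) ↔ α < q.re := by
  have hαc : (α : ℂ) ≠ 0 := by exact_mod_cast hα.ne'
  have h1 : q⁻¹ - 1 / (2 * (α : ℂ)) = (2 * α - q) / (q * (2 * α)) := by field_simp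
  have hqn : 0 < ‖q‖ := norm_pos_iff.2 hq
  have h2 : ‖q * (2 * (α : ℂ))‖ = ‖q‖ * (2 * α) := by simp [abs_of_pos hα]
  rw [h1, norm_div, h2, div_lt_div_iff₀ (by positivity) (by positivity), one_mul,
    mul_lt_mul_iff_left₀ (by positivity), ← sq_lt_sq₀ (norm_nonneg _) hqn.le, Complex.sq_norm,
    Complex.sq_norm, Complex.normSq_apply, Complex.normSq_apply]
  have hre : (2 * (α : ℂ) - q).re = 2 * α - q.re := by simp
  have him : (2 * (α : ℂ) - q).im = -q.im := by simp
  rw [hre, him]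
  constructor <;> intro h <;> nlinarith

lemma hasFDerivAt_smul_self {g : X → ℂ} {z : X} (hg : DifferentiableAt ℂ g z) :
    HasFDerivAt (fun w => g w • w)
      (g z • ContinuousLinearMap.id ℂ X + (fderiv ℂ g z).smulRight z) z :=
  hg.hasFDerivAt.fun_smul (hasFDerivAt_id z)

lemma fderiv_smul_self_apply_self {g : X → ℂ} {z : X} (hg : DifferentiableAt ℂ g z) :
    fderiv ℂ (fun w => g w • w) z z = (g z + fderiv ℂ g z z) • z := by
  rw [(hasFDerivAt_smul_self hg).fderiv]
  simp [add_smul]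

/-- The derivative of `z ↦ g z • z` is a rank one perturbation of a multiple of the identity. -/
lemma isInvertible_smul_id_add_smulRight {a : ℂ} {φ : X →L[ℂ] ℂ} {z : X} (ha : a ≠ 0)
    (haφ : a + φ z ≠ 0) :
    (a • ContinuousLinearMap.id ℂ X + φ.smulRight z).IsInvertible := by
  refine ContinuousLinearMap.IsInvertible.of_inverse
    (g := a⁻¹ • (ContinuousLinearMap.id ℂ X - (a + φ z)⁻¹ • φ.smulRight z)) ?_ ?_
  · ext h
    simp only [ContinuousLinearMap.coe_comp, Function.comp_apply, add_apply, smul_apply,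
      ContinuousLinearMap.id_apply, sub_apply, ContinuousLinearMap.smulRight_apply, map_smul,
      map_sub]
    match_scalars <;> field_simp
    ring
  · ext h
    simp only [ContinuousLinearMap.coe_comp, Function.comp_apply, add_apply, smul_apply,
      ContinuousLinearMap.id_apply, sub_apply, ContinuousLinearMap.smulRight_apply, map_smul,
      map_add]
    match_scalars <;> field_simp
    ring

lemma inverse_fderiv_smul_self {g : X → ℂ} {z : X} (hg : DifferentiableAt ℂ g z)
    (hinv : (fderiv ℂ (fun w => g w • w) z).IsInvertible) (hne : g z + fderiv ℂ g z z ≠ 0) :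
    (fderiv ℂ (fun w => g w • w) z).inverse (g z • z) = (g z / (g z + fderiv ℂ g z z)) • z := by
  rw [hinv.inverse_apply_eq, map_smul, fderiv_smul_self_apply_self hg, smul_smul,
    div_mul_cancel₀ _ hne]

lemma one_div_norm_mul_apply_smul {z : X} (hz : z ≠ 0) {l : X →L[ℂ] ℂ}
    (hl : l ∈ supportFunctionals z) (c : ℂ) : 1 / (‖z‖ : ℂ) * l (c • z) = c := by
  have : (‖z‖ : ℂ) ≠ 0 := by exact_mod_cast norm_ne_zero_iff.2 hz
  rw [map_smul, hl.1, smul_eq_mul]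
  field_simp

/-- For `G z = g z • z`, starlikeness of order `α` says that `(g z + Dg(z) z) / g z` has real part
greater than `α`, since `[DG(z)]⁻¹ G(z)` is the multiple of `z` by the inverse of this quotient. -/
lemma IsStarlikeOfOrder.lt_re {g : X → ℂ} {α : ℝ} (hα : 0 < α)
    (hg : DifferentiableOn ℂ g (ball 0 1)) (hs : IsStarlikeOfOrder α (fun z => g z • z))
    {z : X} (hz : z ∈ ball 0 1) (hz0 : z ≠ 0) :
    g z ≠ 0 ∧ α < ((g z + fderiv ℂ g z z) / g z).re := by
  have hgz : DifferentiableAt ℂ g z := hg.differentiableAt (isOpen_ball.mem_nhds hz)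
  have hinv := hs.locally_biholomorphic z hz
  have hne : g z + fderiv ℂ g z z ≠ 0 := by
    intro h
    have h1 := fderiv_smul_self_apply_self hgz
    rw [h, zero_smul] at h1
    exact hz0 (hinv.injective (h1.trans (_root_.map_zero _).symm))
  obtain ⟨l, hl1, hlz⟩ := exists_dual_vector ℂ z (norm_ne_zero_iff.2 hz0)
  have hl : l ∈ supportFunctionals z := ⟨hlz, hl1⟩
  have h := hs.starlike z hz hz0 l hl
  rw [inverse_fderiv_smul_self hgz hinv hne, one_div_norm_mul_apply_smul hz0 hl] at h
  have hg0 : g z ≠ 0 := by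
    rintro h0
    rw [h0, zero_div, zero_sub, norm_neg] at h
    simp [abs_of_pos hα] at h
  refine ⟨hg0, (norm_inv_sub_lt_iff hα (div_ne_zero hne hg0)).1 ?_⟩
  rwa [inv_div]

lemma isStarlikeOfOrder_smul_self {g : X → ℂ} {α : ℝ} (hα : 0 < α)
    (hg : DifferentiableOn ℂ g (ball 0 1)) (h1 : g 0 = 1)
    (h : ∀ z ∈ ball (0 : X) 1, g z ≠ 0 ∧ α < ((g z + fderiv ℂ g z z) / g z).re) :
    IsStarlikeOfOrder α (fun z => g z • z) := by
  have hgd : ∀ z ∈ ball (0 : X) 1, DifferentiableAt ℂ g z := fun z hz =>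
    hg.differentiableAt (isOpen_ball.mem_nhds hz)
  have hne : ∀ z ∈ ball (0 : X) 1, g z + fderiv ℂ g z z ≠ 0 := fun z hz h0 => by
    have := (h z hz).2
    rw [h0, zero_div, Complex.zero_re] at this
    exact this.not_gt hα
  have hinv : ∀ z ∈ ball (0 : X) 1, (fderiv ℂ (fun w => g w • w) z).IsInvertible := fun z hz => by
    rw [(hasFDerivAt_smul_self (hgd z hz)).fderiv]
    exact isInvertible_smul_id_add_smulRight (h z hz).1 (hne z hz)
  refine ⟨hg.smul differentiableOn_id, by simp, ?_, hinv, fun z hz hz0 l hl => ?_⟩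
  · rw [(hasFDerivAt_smul_self (hgd 0 (mem_ball_self one_pos))).fderiv, h1]
    ext
    simp
  · rw [inverse_fderiv_smul_self (hgd z hz) (hinv z hz) (hne z hz),
      one_div_norm_mul_apply_smul hz0 hl, ← inv_div,
      norm_inv_sub_lt_iff hα (div_ne_zero (hne z hz) (h z hz).1)]
    exact (h z hz).2

end Starlike

/-! ### Homogeneous expansion along complex lines -/

/-- The homogeneous terms of `z ↦ g z • z` are the multiples of `z` by the Taylor coefficients of
`g` along the complex line through `z`. -/
theorem homogeneousTerm_smul_self {X : Type*} [NormedAddCommGroup X] [NormedSpace ℂ X]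
    [CompleteSpace X] {g : X → ℂ} (hg : DifferentiableOn ℂ g (ball 0 1)) (k : ℕ) (z : X) :
    homogeneousTerm (fun z => g z • z) (k + 1) z
      = (iteratedDeriv k (fun t : ℂ => g (t • z)) 0 / k.factorial) • z := by
  -- `L` is the line through `z`, along which `G` is `t ↦ (t ψ(t)) • z`
  set ψ : ℂ → ℂ := fun t => g (t • z) with hψ
  set L : ℂ →L[ℂ] X := ContinuousLinearMap.toSpanSingleton ℂ z with hL
  have hG : ContDiffOn ℂ (k + 1 : ℕ) (fun z => g z • z) (ball 0 1) :=
    contDiffOn_of_differentiableOn_complex isOpen_ball (hg.smul differentiableOn_id) _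
  have hopen : IsOpen (L ⁻¹' ball 0 1) := isOpen_ball.preimage L.continuous
  have h0 : L 0 ∈ ball (0 : X) 1 := by simp
  have hψd : DifferentiableOn ℂ ψ (L ⁻¹' ball 0 1) :=
    hg.comp L.differentiableOn fun t ht => ht
  have hψc : ContDiffAt ℂ (k + 1 : ℕ) ψ 0 := (hψd.contDiffOn hopen).contDiffAt (hopen.mem_nhds h0)
  have key := L.iteratedFDerivWithin_comp_right hG isOpen_ball.uniqueDiffOn hopen.uniqueDiffOn h0
    (i := k + 1) le_rfl
  rw [iteratedFDerivWithin_of_isOpen _ hopen h0, iteratedFDerivWithin_of_isOpen _ isOpen_ball h0,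
    map_zero] at key
  have hline : (fun z => g z • z) ∘ L = fun t => (t * ψ t) • z := by
    funext t
    simp [hL, hψ, smul_smul, mul_comm]
  have hz : iteratedFDeriv ℂ (k + 1) (fun z => g z • z) 0 (fun _ => z)
      = iteratedDeriv (k + 1) (fun t => (t * ψ t) • z) 0 := by
    rw [iteratedDeriv_eq_iteratedFDeriv, ← hline, key]
    simp [hL]
  have hk : ((k.factorial : ℕ) : ℂ) ≠ 0 := by exact_mod_cast k.factorial_ne_zero
  have hk1 : (k : ℂ) + 1 ≠ 0 := by exact_mod_cast k.succ_ne_zero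
  have hleib : iteratedDeriv (k + 1) (fun t => t * ψ t) 0 = (k + 1) * iteratedDeriv k ψ 0 := by
    rw [iteratedDeriv_fun_mul contDiffAt_fun_id hψc, Finset.sum_eq_single 1]
    · simp [iteratedDeriv_fun_id_zero]
    · intro i _ hi
      simp [iteratedDeriv_fun_id_zero, hi]
    · simp
  have hsmul : iteratedDeriv (k + 1) (fun t => (t * ψ t) • z) 0
      = iteratedDeriv (k + 1) (fun t => t * ψ t) 0 • z :=
    iteratedDeriv_smul_const (contDiffAt_fun_id.mul hψc) z
  rw [homogeneousTerm, hz, hsmul, hleib, smul_smul, Nat.factorial_succ]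
  congr 1
  push_cast
  field_simp

/-! ### Coefficient bounds -/

/-- Bounds for the first two Taylor coefficients of `ψ` when `t ↦ t ψ(t)` is starlike of order `α`
on the disc of radius `R`. They come from Carathéodory's inequality for the normalization of
`1 + t ψ'(t) / ψ(t)` to a function with positive real part. -/
lemma norm_coeff_le_of_lt_re {ψ : ℂ → ℂ} {R α : ℝ} (hR : 0 < R) (hα : α < 1)
    (hψ : DifferentiableOn ℂ ψ (ball 0 R)) (h0 : ψ 0 = 1) (hne : ∀ t ∈ ball 0 R, ψ t ≠ 0)
    (hre : ∀ t ∈ ball 0 R, α < (1 + t * (deriv ψ t / ψ t)).re) :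
    ‖deriv ψ 0‖ ≤ 2 * (1 - α) / R ∧
      ‖iteratedDeriv 2 ψ 0 / 2‖ ≤ (1 - α) * (3 - 2 * α) / R ^ 2 := by
  have hα' : 0 < 1 - α := sub_pos.2 hα
  have hαc : (1 - α : ℂ) ≠ 0 := by exact_mod_cast hα'.ne'
  -- with `Λ = ψ' / ψ`, the function `p` has real part positive and `p(0) = 1`
  set Λ : ℂ → ℂ := fun t => deriv ψ t / ψ t with hΛ
  have hΛd : DifferentiableOn ℂ Λ (ball 0 R) := (hψ.deriv isOpen_ball).div hψ hne
  have hmem : (0 : ℂ) ∈ ball 0 R := mem_ball_self hR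
  have hΛ0 : Λ 0 = deriv ψ 0 := by simp [hΛ, h0]
  have hΛ1 : deriv Λ 0 = iteratedDeriv 2 ψ 0 - (deriv ψ 0) ^ 2 := by
    have h1 := ((hψ.deriv isOpen_ball).differentiableAt (isOpen_ball.mem_nhds hmem)).hasDerivAt
    have h2 := (hψ.differentiableAt (isOpen_ball.mem_nhds hmem)).hasDerivAt
    rw [(h1.fun_div h2 (hne 0 hmem)).deriv, h0, iteratedDeriv_succ, iteratedDeriv_one]
    ring
  set p : ℂ → ℂ := fun t => 1 + t * Λ t / (1 - α) with hp
  have hpd : ∀ t ∈ ball (0 : ℂ) R, HasDerivAt p ((Λ t + t * deriv Λ t) / (1 - α)) t := by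
    intro t ht
    have h1 := (hΛd.differentiableAt (isOpen_ball.mem_nhds ht)).hasDerivAt
    have h2 := (((hasDerivAt_id' t).fun_mul h1).div_const (1 - α : ℂ)).const_add 1
    rwa [one_mul] at h2
  have hpre : ∀ t ∈ ball (0 : ℂ) R, 0 < (p t).re := by
    intro t ht
    have h1 := hre t ht
    have h2 : (p t).re = 1 + (t * Λ t).re / (1 - α) := by
      have : (1 - α : ℂ) = ((1 - α : ℝ) : ℂ) := by push_cast; rfl
      simp only [hp, this, Complex.add_re, Complex.one_re, Complex.div_ofReal_re]
    have h3 : (1 + t * Λ t).re = 1 + (t * Λ t).re := by simp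
    rw [h3] at h1
    rw [h2, ← sub_neg_eq_add, sub_pos, ← neg_div, div_lt_one hα']
    linarith
  have hcar := fun n => norm_iteratedDeriv_le_of_re_pos (n := n) hR
    (fun t ht => (hpd t ht).differentiableAt.differentiableWithinAt) (by simp [hp]) hpre
  have hp1 : iteratedDeriv 1 p 0 = deriv ψ 0 / (1 - α) := by
    rw [iteratedDeriv_one, (hpd 0 hmem).deriv, hΛ0]
    simp
  have hp2 : iteratedDeriv 2 p 0 = 2 * deriv Λ 0 / (1 - α) := by
    have hev : deriv p =ᶠ[nhds 0] fun t => (Λ t + t * deriv Λ t) / (1 - α) := by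
      filter_upwards [isOpen_ball.mem_nhds hmem] with t ht using (hpd t ht).deriv
    rw [iteratedDeriv_succ, iteratedDeriv_one, hev.deriv_eq]
    have h1 := (hΛd.differentiableAt (isOpen_ball.mem_nhds hmem)).hasDerivAt
    have h2 := ((hΛd.deriv isOpen_ball).differentiableAt (isOpen_ball.mem_nhds hmem)).hasDerivAt
    rw [((h1.fun_add ((hasDerivAt_id' (0 : ℂ)).fun_mul h2)).div_const (1 - α : ℂ)).deriv]
    simp
    ring
  have hnα : ‖(1 - α : ℂ)‖ = 1 - α := by
    rw [← Complex.ofReal_one, ← Complex.ofReal_sub, Complex.norm_real, Real.norm_of_nonneg hα'.le]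
  have hb1 : ‖deriv ψ 0‖ ≤ 2 * (1 - α) / R := by
    have := hcar 1 one_ne_zero
    rw [hp1, norm_div, hnα, div_le_iff₀ hα'] at this
    refine this.trans_eq ?_
    simp
    ring
  have hb2 : ‖deriv Λ 0‖ ≤ 2 * (1 - α) / R ^ 2 := by
    have := hcar 2 two_ne_zero
    rw [hp2, norm_div, hnα, div_le_iff₀ hα', norm_mul, Complex.norm_two, Nat.factorial_two] at this
    rw [le_div_iff₀ (by positivity)]
    rw [div_mul_eq_mul_div, le_div_iff₀ (by positivity)] at this
    push_cast at this
    linarith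
  refine ⟨hb1, ?_⟩
  have h2 : iteratedDeriv 2 ψ 0 = deriv Λ 0 + (deriv ψ 0) ^ 2 := by rw [hΛ1]; ring
  rw [norm_div, h2, Complex.norm_two, div_le_iff₀ two_pos]
  calc ‖deriv Λ 0 + (deriv ψ 0) ^ 2‖ ≤ ‖deriv Λ 0‖ + ‖deriv ψ 0‖ ^ 2 :=
        (norm_add_le _ _).trans_eq (by rw [norm_pow])
    _ ≤ 2 * (1 - α) / R ^ 2 + (2 * (1 - α) / R) ^ 2 := by gcongr
    _ = _ := by field_simp; ring

/-- The second and third order coefficients of a starlike map `z ↦ g z • z` of order `α` along the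
line through `z`. -/
lemma IsStarlikeOfOrder.norm_coeff_le {X : Type*} [NormedAddCommGroup X] [NormedSpace ℂ X]
    {g : X → ℂ} {α : ℝ} (hα0 : 0 < α) (hα1 : α < 1) (hg : DifferentiableOn ℂ g (ball 0 1))
    (h1 : g 0 = 1) (hs : IsStarlikeOfOrder α (fun z => g z • z)) {z : X} (hz0 : z ≠ 0) :
    ‖iteratedDeriv 1 (fun t : ℂ => g (t • z)) 0‖ ≤ 2 * (1 - α) * ‖z‖ ∧
      ‖iteratedDeriv 2 (fun t : ℂ => g (t • z)) 0 / 2‖ ≤ (1 - α) * (3 - 2 * α) * ‖z‖ ^ 2 := by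
  have hzp : 0 < ‖z‖ := norm_pos_iff.2 hz0
  have hmem : ∀ t ∈ ball (0 : ℂ) ‖z‖⁻¹, t • z ∈ ball (0 : X) 1 := fun t ht => by
    rw [mem_ball_zero_iff, norm_smul, ← lt_div_iff₀ hzp, one_div]
    exact mem_ball_zero_iff.1 ht
  have hd : ∀ t ∈ ball (0 : ℂ) ‖z‖⁻¹,
      HasDerivAt (fun t : ℂ => g (t • z)) (fderiv ℂ g (t • z) z) t := fun t ht => by
    have hgt := (hg.differentiableAt (isOpen_ball.mem_nhds (hmem t ht))).hasFDerivAt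
    have hl : HasDerivAt (fun t : ℂ => t • z) z t := by
      simpa using (hasDerivAt_id t).smul_const z
    exact hgt.comp_hasDerivAt t hl
  have key := norm_coeff_le_of_lt_re (ψ := fun t : ℂ => g (t • z)) (inv_pos.2 hzp) hα1
    (fun t ht => (hd t ht).differentiableAt.differentiableWithinAt) (by simp [h1]) ?_ ?_
  · simpa [iteratedDeriv_one] using key
  · intro t ht
    rcases eq_or_ne t 0 with rfl | ht0
    · simp [h1]
    · exact (hs.lt_re hα0 hg (hmem t ht) (smul_ne_zero ht0 hz0)).1
  · intro t ht
    rcases eq_or_ne t 0 with rfl | ht0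
    · simpa using hα1
    · have := hs.lt_re hα0 hg (hmem t ht) (smul_ne_zero ht0 hz0)
      rw [(hd t ht).deriv]
      convert this.2 using 2
      rw [add_div, div_self this.1, map_smul, smul_eq_mul, mul_div_assoc]

/-! ### The extremal maps -/

section Extremal

open Complex

lemma hasDerivAt_one_sub_mul_cpow {a β t : ℂ} (ht : 1 - a * t ∈ slitPlane) :
    HasDerivAt (fun t => (1 - a * t) ^ β) (-a * β * (1 - a * t) ^ (β - 1)) t := by
  have h : HasDerivAt (fun t => 1 - a * t) (-a) t := by
    simpa using ((hasDerivAt_id t).const_mul a).const_sub 1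
  convert h.cpow_const ht using 1
  ring

lemma iteratedDeriv_one_sub_mul_cpow (a β : ℂ) :
    iteratedDeriv 1 (fun t => (1 - a * t) ^ β) 0 = -a * β ∧
      iteratedDeriv 2 (fun t => (1 - a * t) ^ β) 0 = a ^ 2 * β * (β - 1) := by
  have hev : ∀ᶠ t : ℂ in nhds 0, 1 - a * t ∈ slitPlane := by
    have : Continuous fun t : ℂ => 1 - a * t := by fun_prop
    exact this.continuousAt.eventually_mem (isOpen_slitPlane.mem_nhds (by simp))
  have h1 : deriv (fun t => (1 - a * t) ^ β) =ᶠ[nhds 0]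
      fun t => -a * β * (1 - a * t) ^ (β - 1) := by
    filter_upwards [hev] with t ht using (hasDerivAt_one_sub_mul_cpow ht).deriv
  refine ⟨by simp [iteratedDeriv_one, h1.eq_of_nhds], ?_⟩
  rw [iteratedDeriv_succ, iteratedDeriv_one, h1.deriv_eq,
    ((hasDerivAt_one_sub_mul_cpow hev.self_of_nhds).const_mul (-a * β)).deriv]
  simp
  ring

variable {X : Type*} [NormedAddCommGroup X] [NormedSpace ℂ X]

/-- The extremal factor `(1 - i u(z)) ^ (-2 (1 - α))`, built from a linear functional `u`. The
factor `i` gives the squares of the second and third coefficients opposite signs. -/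
noncomputable def extremalFactor (α : ℝ) (u : X →L[ℂ] ℂ) (z : X) : ℂ :=
  (1 - I * u z) ^ (-(2 * (1 - α)) : ℂ)

variable {α : ℝ} {u : X →L[ℂ] ℂ}

lemma norm_apply_lt_one_of_mem_ball (hu : ‖u‖ ≤ 1) {z : X} (hz : z ∈ ball (0 : X) 1) :
    ‖I * u z‖ < 1 := by
  rw [norm_mul, norm_I, one_mul]
  exact (u.le_of_opNorm_le hu z).trans_lt (by simpa using hz)

lemma one_sub_mem_slitPlane_of_norm_lt_one {w : ℂ} (hw : ‖w‖ < 1) : 1 - w ∈ slitPlane := by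
  refine Or.inl ?_
  have := (re_le_norm w).trans_lt hw
  simpa using this

lemma hasFDerivAt_extremalFactor (hu : ‖u‖ ≤ 1) {z : X} (hz : z ∈ ball (0 : X) 1) :
    HasFDerivAt (extremalFactor α u)
      ((2 * (1 - α) * I * (1 - I * u z) ^ (-(2 * (1 - α)) - 1 : ℂ)) • u) z := by
  have hs := one_sub_mem_slitPlane_of_norm_lt_one (norm_apply_lt_one_of_mem_ball hu hz)
  have h : HasFDerivAt (extremalFactor α u) _ z :=
    (hasDerivAt_one_sub_mul_cpow (β := (-(2 * (1 - α)) : ℂ)) hs).comp_hasFDerivAt z u.hasFDerivAt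
  exact h.congr_fderiv (by congr 1; ring)

lemma extremalFactor_zero : extremalFactor α u 0 = 1 := by simp [extremalFactor]

lemma differentiableOn_extremalFactor (hu : ‖u‖ ≤ 1) :
    DifferentiableOn ℂ (extremalFactor α u) (ball 0 1) := fun _ hz =>
  (hasFDerivAt_extremalFactor hu hz).differentiableAt.differentiableWithinAt

lemma isStarlikeOfOrder_extremalFactor (hα0 : 0 < α) (hα1 : α < 1) (hu : ‖u‖ ≤ 1) :
    IsStarlikeOfOrder α (fun z => extremalFactor α u z • z) := by
  refine isStarlikeOfOrder_smul_self hα0 (differentiableOn_extremalFactor hu)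
    extremalFactor_zero fun z hz => ?_
  have hw := norm_apply_lt_one_of_mem_ball hu hz
  have hs := one_sub_mem_slitPlane_of_norm_lt_one hw
  have hs0 : 1 - I * u z ≠ 0 := slitPlane_ne_zero hs
  have hg0 : extremalFactor α u z ≠ 0 := by
    rw [extremalFactor, Ne, cpow_eq_zero_iff]
    exact fun h => hs0 h.1
  refine ⟨hg0, ?_⟩
  have hq : (extremalFactor α u z + fderiv ℂ (extremalFactor α u) z z) / extremalFactor α u z
      = (α : ℂ) + ((1 - α : ℝ) : ℂ) * ((1 + I * u z) / (1 - I * u z)) := by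
    rw [(hasFDerivAt_extremalFactor hu hz).fderiv, smul_apply, smul_eq_mul, cpow_sub _ _ hs0,
      cpow_one]
    rw [← extremalFactor]
    push_cast
    field_simp
    ring
  rw [hq, add_re, ofReal_re, re_ofReal_mul]
  have hpos : 0 < ((1 + I * u z) / (1 - I * u z)).re := by
    generalize I * u z = w at *
    rw [div_re, ← add_div]
    refine div_pos ?_ (normSq_pos.2 hs0)
    have : normSq w < 1 := by
      rw [normSq_eq_norm_sq]; nlinarith [norm_nonneg w]
    rw [normSq_apply] at this
    simp
    nlinarith
  have := mul_pos (sub_pos.2 hα1) hpos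
  linarith

lemma homogeneousTerm_extremalFactor [CompleteSpace X] (hu : ‖u‖ ≤ 1) (z : X) :
    homogeneousTerm (fun z => extremalFactor α u z • z) 2 z = (2 * (1 - α) * I * u z) • z ∧
      homogeneousTerm (fun z => extremalFactor α u z • z) 3 z
        = (-((1 - α) * (3 - 2 * α) * u z ^ 2)) • z := by
  have hψ : (fun t : ℂ => extremalFactor α u (t • z))
      = fun t => (1 - I * u z * t) ^ (-(2 * (1 - α)) : ℂ) := by
    funext t
    rw [extremalFactor, map_smul, smul_eq_mul, mul_assoc, mul_comm t]
  have h := iteratedDeriv_one_sub_mul_cpow (I * u z) (-(2 * (1 - α)) : ℂ)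
  rw [homogeneousTerm_smul_self (differentiableOn_extremalFactor hu) 1 z,
    homogeneousTerm_smul_self (differentiableOn_extremalFactor hu) 2 z, hψ, h.1, h.2]
  refine ⟨?_, ?_⟩ <;> congr 1
  · simp
    ring
  · rw [mul_pow, I_sq, Nat.factorial_two]
    push_cast
    ring

end Extremal

/-! ### Sharp estimates of the second and third homogeneous terms -/

theorem mainTheorem10 (α : ℝ) (hα0 : 0 < α) (hα1 : α < 1)
    (X : Type*) [NormedAddCommGroup X] [NormedSpace ℂ X] [CompleteSpace X] [Nontrivial X]
    (n : ℕ) (hn : 1 ≤ n) :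
    -- the unit ball of the complex Banach space `X`: the estimate and its sharpness
    ((∀ g : X → ℂ, DifferentiableOn ℂ g (ball 0 1) → g 0 = 1 →
        IsStarlikeOfOrder α (fun z => g z • z) →
        ∀ z ∈ ball (0 : X) 1, z ≠ 0 → ∀ l ∈ supportFunctionals z,
          ‖(l (homogeneousTerm (fun z => g z • z) 2 z) / (‖z‖ : ℂ) ^ 2) ^ 2
              - (l (homogeneousTerm (fun z => g z • z) 3 z) / (‖z‖ : ℂ) ^ 3) ^ 2‖
            ≤ (1 - α) ^ 2 * (4 * α ^ 2 - 12 * α + 13)) ∧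
      (∃ g : X → ℂ, DifferentiableOn ℂ g (ball 0 1) ∧ g 0 = 1 ∧
        IsStarlikeOfOrder α (fun z => g z • z) ∧
        ∃ z ∈ ball (0 : X) 1, z ≠ 0 ∧ ∃ l ∈ supportFunctionals z,
          ‖(l (homogeneousTerm (fun z => g z • z) 2 z) / (‖z‖ : ℂ) ^ 2) ^ 2
              - (l (homogeneousTerm (fun z => g z • z) 3 z) / (‖z‖ : ℂ) ^ 3) ^ 2‖
            = (1 - α) ^ 2 * (4 * α ^ 2 - 12 * α + 13))) ∧
    -- the unit polydisc of `ℂⁿ` (maximum norm, coordinatewise squares): the same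
    ((∀ g : (Fin n → ℂ) → ℂ, DifferentiableOn ℂ g (ball 0 1) → g 0 = 1 →
        IsStarlikeOfOrder α (fun z => g z • z) →
        ∀ z ∈ ball (0 : Fin n → ℂ) 1,
          ‖(homogeneousTerm (fun z => g z • z) 3 z) ^ 2
              - (homogeneousTerm (fun z => g z • z) 2 z) ^ 2‖
            ≤ (1 - α) ^ 2 * ((3 - 2 * α) ^ 2 * ‖z‖ ^ 6 + 4 * ‖z‖ ^ 4)) ∧
      (∃ g : (Fin n → ℂ) → ℂ, DifferentiableOn ℂ g (ball 0 1) ∧ g 0 = 1 ∧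
        IsStarlikeOfOrder α (fun z => g z • z) ∧
        ∀ r : ℝ, 0 ≤ r → r < 1 → ∃ z : Fin n → ℂ, ‖z‖ = r ∧
          ‖(homogeneousTerm (fun z => g z • z) 3 z) ^ 2
              - (homogeneousTerm (fun z => g z • z) 2 z) ^ 2‖
            = (1 - α) ^ 2 * ((3 - 2 * α) ^ 2 * ‖z‖ ^ 6 + 4 * ‖z‖ ^ 4))) := by
  refine ⟨⟨fun g hg h1 hs z hz hz0 l hl => ?_, ?_⟩, fun g hg h1 hs z hz => ?_, ?_⟩
  · have hzp : 0 < ‖z‖ := norm_pos_iff.2 hz0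
    have hzc : (‖z‖ : ℂ) ≠ 0 := by exact_mod_cast hzp.ne'
    obtain ⟨hb1, hb2⟩ := hs.norm_coeff_le hα0 hα1 hg h1 hz0
    rw [homogeneousTerm_smul_self hg 1 z, homogeneousTerm_smul_self hg 2 z, map_smul, map_smul,
      hl.1, smul_eq_mul, smul_eq_mul, Nat.factorial_one, Nat.factorial_two, Nat.cast_one, div_one,
      Nat.cast_two]
    generalize iteratedDeriv 1 (fun t : ℂ => g (t • z)) 0 = a at *
    generalize iteratedDeriv 2 (fun t : ℂ => g (t • z)) 0 / 2 = b at *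
    have ha : ‖a * ‖z‖ / (‖z‖ : ℂ) ^ 2‖ ≤ 2 * (1 - α) := by
      have : a * ‖z‖ / (‖z‖ : ℂ) ^ 2 = a / ‖z‖ := by field_simp
      rw [this, norm_div, Complex.norm_real, norm_norm, div_le_iff₀ hzp]
      exact hb1
    have hb : ‖b * ‖z‖ / (‖z‖ : ℂ) ^ 3‖ ≤ (1 - α) * (3 - 2 * α) := by
      have : b * ‖z‖ / (‖z‖ : ℂ) ^ 3 = b / (‖z‖ : ℂ) ^ 2 := by field_simp
      rw [this, norm_div, norm_pow, Complex.norm_real, norm_norm, div_le_iff₀ (by positivity)]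
      exact hb2
    calc _ ≤ ‖a * ‖z‖ / (‖z‖ : ℂ) ^ 2‖ ^ 2 + ‖b * ‖z‖ / (‖z‖ : ℂ) ^ 3‖ ^ 2 :=
          (norm_sub_le _ _).trans_eq (by rw [norm_pow, norm_pow])
      _ ≤ (2 * (1 - α)) ^ 2 + ((1 - α) * (3 - 2 * α)) ^ 2 := by gcongr
      _ = _ := by ring
  · -- `u` is norming for `x`, and `z` is the multiple of `x` of norm `1 / 2`
    obtain ⟨x, hx⟩ := exists_ne (0 : X)
    obtain ⟨u, hu1, hux⟩ := exists_dual_vector ℂ x (norm_ne_zero_iff.2 hx)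
    replace hux : u x = (‖x‖ : ℂ) := hux
    have hxc : (‖x‖ : ℂ) ≠ 0 := by exact_mod_cast norm_ne_zero_iff.2 hx
    obtain ⟨z, hz⟩ : ∃ z : X, z = ((2 * ‖x‖ : ℝ) : ℂ)⁻¹ • x := ⟨_, rfl⟩
    have hzn : ‖z‖ = 1 / 2 := by
      rw [hz, norm_smul, norm_inv, Complex.norm_real, Real.norm_of_nonneg (by positivity)]
      field_simp [norm_ne_zero_iff.2 hx]
    have huz : u z = 1 / 2 := by
      rw [hz, map_smul, hux, smul_eq_mul]
      push_cast
      field_simp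
    refine ⟨extremalFactor α u, differentiableOn_extremalFactor hu1.le, extremalFactor_zero,
      isStarlikeOfOrder_extremalFactor hα0 hα1 hu1.le, z, ?_, ?_, u, ⟨?_, hu1⟩, ?_⟩
    · rw [mem_ball_zero_iff, hzn]; norm_num
    · rw [← norm_ne_zero_iff, hzn]; norm_num
    · rw [huz, hzn]; norm_num
    · obtain ⟨h2, h3⟩ := homogeneousTerm_extremalFactor (α := α) hu1.le z
      rw [h2, h3, map_smul, map_smul, smul_eq_mul, smul_eq_mul, huz, hzn]
      have : (2 * (1 - (α : ℂ)) * Complex.I * (1 / 2) * (1 / 2) / ((1 / 2 : ℝ) : ℂ) ^ 2) ^ 2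
          - (-((1 - (α : ℂ)) * (3 - 2 * α) * (1 / 2) ^ 2) * (1 / 2) / ((1 / 2 : ℝ) : ℂ) ^ 3) ^ 2
          = ((-((1 - α) ^ 2 * (4 * α ^ 2 - 12 * α + 13)) : ℝ) : ℂ) := by
        push_cast
        linear_combination 4 * (1 - (α : ℂ)) ^ 2 * Complex.I_sq
      rw [this, Complex.norm_real, norm_neg, Real.norm_of_nonneg]
      nlinarith [mul_nonneg (sq_nonneg (1 - α)) (sq_nonneg (2 * α - 3)), sq_nonneg (1 - α)]
  · rcases eq_or_ne z 0 with rfl | hz0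
    · rw [homogeneousTerm_smul_self hg 1 0, homogeneousTerm_smul_self hg 2 0]
      simp
    obtain ⟨hb1, hb2⟩ := hs.norm_coeff_le hα0 hα1 hg h1 hz0
    rw [homogeneousTerm_smul_self hg 1 z, homogeneousTerm_smul_self hg 2 z, Nat.factorial_one,
      Nat.factorial_two, Nat.cast_one, div_one, Nat.cast_two]
    generalize iteratedDeriv 1 (fun t : ℂ => g (t • z)) 0 = a at *
    generalize iteratedDeriv 2 (fun t : ℂ => g (t • z)) 0 / 2 = b at *
    calc _ ≤ ‖b • z‖ ^ 2 + ‖a • z‖ ^ 2 := (norm_sub_le _ _).trans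
          (add_le_add (norm_pow_le' _ two_pos) (norm_pow_le' _ two_pos))
      _ = (‖b‖ * ‖z‖) ^ 2 + (‖a‖ * ‖z‖) ^ 2 := by rw [norm_smul, norm_smul]
      _ ≤ ((1 - α) * (3 - 2 * α) * ‖z‖ ^ 2 * ‖z‖) ^ 2 + (2 * (1 - α) * ‖z‖ * ‖z‖) ^ 2 := by gcongr
      _ = _ := by ring
  · -- with `u` a coordinate, equality holds on the diagonal of the polydisc
    have : Nonempty (Fin n) := ⟨⟨0, hn⟩⟩
    set u : (Fin n → ℂ) →L[ℂ] ℂ := ContinuousLinearMap.proj ⟨0, hn⟩ with hu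
    have hu1 : ‖u‖ ≤ 1 := u.opNorm_le_bound zero_le_one fun z => by
      rw [one_mul]
      exact norm_le_pi_norm z _
    refine ⟨extremalFactor α u, differentiableOn_extremalFactor hu1, extremalFactor_zero,
      isStarlikeOfOrder_extremalFactor hα0 hα1 hu1, fun r hr0 hr1 => ?_⟩
    have hnorm : ‖(fun _ => (r : ℂ) : Fin n → ℂ)‖ = r := by
      rw [pi_norm_const, Complex.norm_real, Real.norm_of_nonneg hr0]
    refine ⟨fun _ => (r : ℂ), hnorm, ?_⟩
    obtain ⟨h2, h3⟩ := homogeneousTerm_extremalFactor (α := α) hu1 (fun _ => (r : ℂ))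
    rw [h2, h3, hnorm]
    have hvec : ((-((1 - (α : ℂ)) * (3 - 2 * α) * u (fun _ => (r : ℂ)) ^ 2)) •
          (fun _ => (r : ℂ) : Fin n → ℂ)) ^ 2
        - ((2 * (1 - (α : ℂ)) * Complex.I * u (fun _ => (r : ℂ))) •
          (fun _ => (r : ℂ) : Fin n → ℂ)) ^ 2
        = fun _ => (((1 - α) ^ 2 * ((3 - 2 * α) ^ 2 * r ^ 6 + 4 * r ^ 4) : ℝ) : ℂ) := by
      funext i
      simp only [hu, ContinuousLinearMap.proj_apply, Pi.sub_apply, Pi.pow_apply, Pi.smul_apply,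
        smul_eq_mul]
      push_cast
      linear_combination (-4) * (1 - (α : ℂ)) ^ 2 * r ^ 4 * Complex.I_sq
    rw [hvec, pi_norm_const, Complex.norm_real, Real.norm_of_nonneg (by positivity)]
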